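/- Let $\lambda$ denote the security parameter and let $n,\ell:\mathbb N\to\mathbb N$ satisfy $n(\lambda)=\omega(\log\lambda)$ (for instance $n(\lambda)\ge\lambda$) and $\ell(\lambda)=\omega(\lambda/\log\lambda)$. Let $\mu_n$ be the Haar probability measure on the unitary group of $n$ qubits. For every $\lambda$ let $\{G_k^U\}_{k\in\{0,1\}^\lambda}$ be a set of oracle algorithms such that for every $k$ there are $n(\lambda)$-qubit unitaries $A_k,B_k$ (for example, but not necessarily, efficiently implementable ones) with $G_k^U=B_k\,U\,A_k$ for every $n(\lambda)$-qubit unitary $U$; that is, $G_k$ makes a single call to the oracle $U$. **Security notion.** In the inverseless quantum Haar random oracle model, a two-oracle adversary has oracle access (without inverses) to a challenge oracle $W$ and to the common oracle $U$, both acting on $n(\lambda)$ qubits. It is computationally unbounded: it has any number of ancillary qubits, starts in $|0\rangle$, alternates arbitrary unitaries with queries to one of the two oracles, and ends with a two-outcome projective measurement. The family $\{G_k^U\}$ is an *$\ell$-query secure pseudorandom unitary* if for every family of adversaries $\mathcal A_\lambda$ making at most $\ell(\lambda)$ queries to the challenge oracle and at most polynomially many (in $\lambda$) queries to the common oracle there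 is a negligible function $\varepsilon$ such that for all $\lambda$ $$\Bigl|\Pr_{k\leftarrow\{0,1\}^\lambda,\;U\leftarrow\mu_{n(\lambda)}}\bigl[1\leftarrow\mathcal A_\lambda^{G_k^U,\,U}\bigr]-\Pr_{U,V\leftarrow\mu_{n(\lambda)}}\bigl[1\leftarrow\mathcal A_\lambda^{V,\,U}\bigr]\Bigr|\le\varepsilon(\lambda),$$ where $U$ and $V$ are independent. An adversary is *non-adaptive* if it prepares a state, makes all its queries to both oracles in parallel on separate registers of that state, and then performs a two-outcome projective measurement. **Theorem.** Under these assumptions $\{G_k^U\}_{k\in\{0,1\}^\lambda}$ is not an $\ell$-query secure pseudorandom unitary. It is not even $\ell$-query secure against non-adaptive adversaries. -/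

import Mathlib

open scoped Kronecker Matrix

noncomputable section

namespace HaarPRU

/-- Labels of the computational basis of `n` qubits; also the set of `n`-bit strings. -/
abbrev Qubits (n : ℕ) : Type := Fin n → Bool

/-- The group `U(2^n)` of unitary operators on `n` qubits. -/
abbrev UnitaryOp (n : ℕ) : Type := Matrix.unitaryGroup (Qubits n) ℂ

/-! ### The Haar probability measure on `U(2^n)` -/

instance instCompactSpaceUnitaryOp (n : ℕ) : CompactSpace (UnitaryOp n) := by
  refine isCompact_iff_compactSpace.mp (?_ : IsCompact ((Matrix.unitaryGroup (Qubits n) ℂ :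
    Submonoid _) : Set (Matrix (Qubits n) (Qubits n) ℂ)))
  have hc : IsClosed ((Matrix.unitaryGroup (Qubits n) ℂ : Submonoid _) :
      Set (Matrix (Qubits n) (Qubits n) ℂ)) := isClosed_unitary
  have hK : IsCompact (Set.univ.pi (fun _ : Qubits n => Set.univ.pi
      (fun _ : Qubits n => Metric.closedBall (0 : ℂ) 1))) :=
    isCompact_univ_pi fun _ => isCompact_univ_pi fun _ => isCompact_closedBall _ _
  refine hK.of_isClosed_subset hc ?_
  intro M hM i _ j _
  simpa using entry_norm_bound_of_unitary hM i j

instance instMeasurableSpaceUnitaryOp (n : ℕ) : MeasurableSpace (UnitaryOp n) :=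
  borel (UnitaryOp n)

instance instBorelSpaceUnitaryOp (n : ℕ) : BorelSpace (UnitaryOp n) := ⟨rfl⟩

/-- The Haar measure `μ_n` on the unitary group of `n` qubits, of total mass one. -/
def haarUnitary (n : ℕ) : MeasureTheory.Measure (UnitaryOp n) :=
  MeasureTheory.Measure.haarMeasure ⊤

instance instIsHaarMeasureHaarUnitary (n : ℕ) : (haarUnitary n).IsHaarMeasure := by
  unfold haarUnitary; infer_instance

instance instIsProbabilityMeasureHaarUnitary (n : ℕ) :
    MeasureTheory.IsProbabilityMeasure (haarUnitary n) :=
  ⟨by simpa [haarUnitary] using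
    MeasureTheory.Measure.haarMeasure_self (K₀ := (⊤ : TopologicalSpace.PositiveCompacts
      (UnitaryOp n)))⟩

/-! ### Distinguishing a keyed oracle construction from an independent Haar unitary -/

/-- A nonnegative function of the security parameter that tends to zero faster than every
inverse polynomial. -/
def Negligible (ε : ℕ → ℝ) : Prop :=
  (∀ lam, 0 ≤ ε lam) ∧
    Asymptotics.SuperpolynomialDecay Filter.atTop (fun lam : ℕ => (lam : ℝ)) ε

/-- A set of oracle algorithms with keys of `lam` bits: for each key and each unitary oracle `U`
on `n lam` qubits, the unitary `G_k^U` on `n lam` qubits that the algorithm implements. -/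
abbrev OracleConstruction (n : ℕ → ℕ) : Type :=
  ∀ lam : ℕ, Qubits lam → UnitaryOp (n lam) → UnitaryOp (n lam)

/-- For a two-oracle experiment which outputs `1` with probability `acc W U` when its first
(challenge) oracle is `W` and its second (common) oracle is `U`, the distance
`|Pr_{k, U}[acc G_k^U U] - Pr_{U, V}[acc V U]|`, with `k` a uniform `lam`-bit key and `U`, `V`
independent Haar unitaries. -/
def advantage {n : ℕ} (lam : ℕ) (G : Qubits lam → UnitaryOp n → UnitaryOp n)
    (acc : UnitaryOp n → UnitaryOp n → ℝ) : ℝ :=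
  |(∑ k : Qubits lam, ∫ U, acc (G k U) U ∂(haarUnitary n)) / 2 ^ lam
    - ∫ U, ∫ V, acc V U ∂(haarUnitary n) ∂(haarUnitary n)|

/-- The two oracles available in the security experiment. -/
inductive OracleName where
  /-- The challenge oracle: the construction, or an independent Haar unitary. -/
  | challenge
  /-- The common Haar random oracle. -/
  | haar
  deriving DecidableEq

/-- An adaptive two-oracle adversary, computationally unbounded, without access to inverses.
It has an `n`-qubit query register and an `anc`-qubit ancillary register. It is given by a list of
steps, each a unitary on both registers followed by one query, made on the query register to the
named oracle, and by a final two-outcome projective measurement. -/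
structure Adversary (n : ℕ) where
  /-- Number of ancillary qubits. -/
  anc : ℕ
  /-- The steps, first step at the head of the list. -/
  steps : List (Matrix.unitaryGroup (Qubits n × Qubits anc) ℂ × OracleName)
  /-- The projection of the outcome `1` of the final measurement. -/
  meas : Matrix (Qubits n × Qubits anc) (Qubits n × Qubits anc) ℂ
  isStarProjection_meas : IsStarProjection meas

namespace Adversary

variable {n : ℕ}

/-- Number of queries made to the given oracle. -/
def queries (𝒜 : Adversary n) (o : OracleName) : ℕ :=
  𝒜.steps.countP fun s => s.2 = o

/-- The final state `∏ᵢ (O⁽ⁱ⁾ ⊗ 1) A⁽ⁱ⁾ |0⟩` of the adversary. -/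
def view (𝒜 : Adversary n) (W U : UnitaryOp n) : Qubits n × Qubits 𝒜.anc → ℂ :=
  𝒜.steps.foldl
    (fun ψ s =>
      ((match s.2 with
          | .challenge => (W : Matrix (Qubits n) (Qubits n) ℂ)
          | .haar => (U : Matrix (Qubits n) (Qubits n) ℂ)) ⊗ₖ
        (1 : Matrix (Qubits 𝒜.anc) (Qubits 𝒜.anc) ℂ)) *ᵥ
      ((s.1 : Matrix (Qubits n × Qubits 𝒜.anc) (Qubits n × Qubits 𝒜.anc) ℂ) *ᵥ ψ))
    (Pi.single (fun _ => false, fun _ => false) 1)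

/-- The probability that the adversary outputs `1`. -/
def acceptProb (𝒜 : Adversary n) (W U : UnitaryOp n) : ℝ :=
  ∑ x, ‖(𝒜.meas *ᵥ 𝒜.view W U) x‖ ^ 2

end Adversary

/-- `ℓ`-query security as a pseudorandom unitary in the inverseless quantum Haar random oracle
model: every adversary that makes at most `ℓ` queries to the challenge oracle and polynomially
many queries to the common Haar oracle has negligible advantage. -/
def IsQuerySecurePRU (n ℓ : ℕ → ℕ) (G : OracleConstruction n) : Prop :=
  ∀ 𝒜 : ∀ lam, Adversary (n lam),
    (∀ lam, (𝒜 lam).queries .challenge ≤ ℓ lam) →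
    (∃ p : Polynomial ℕ, ∀ lam, (𝒜 lam).queries .haar ≤ p.eval lam) →
    ∃ ε, Negligible ε ∧ ∀ lam, advantage lam (G lam) (𝒜 lam).acceptProb ≤ ε lam

/-! ### Non-adaptive adversaries -/

/-- The `c`-fold tensor power of an operator on `n` qubits. -/
def tensorPow {n : ℕ} (c : ℕ) (M : Matrix (Qubits n) (Qubits n) ℂ) :
    Matrix (Fin c → Qubits n) (Fin c → Qubits n) ℂ :=
  Matrix.of fun x y => ∏ i, M (x i) (y i)

/-- A non-adaptive two-oracle adversary: it prepares a state, makes all its queries to both oracles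
in parallel on separate registers, and performs a two-outcome projective measurement on
everything. -/
structure NonadaptiveAdversary (n : ℕ) where
  /-- Number of queries to the challenge oracle. -/
  numChallenge : ℕ
  /-- Number of queries to the common Haar oracle. -/
  numHaar : ℕ
  /-- Number of ancillary qubits. -/
  anc : ℕ
  /-- The state that is prepared before the queries. -/
  init : ((Fin numChallenge → Qubits n) × (Fin numHaar → Qubits n)) × Qubits anc → ℂ
  norm_init : ∑ x, ‖init x‖ ^ 2 = 1
  /-- The projection of the outcome `1` of the final measurement. -/
  meas : Matrix (((Fin numChallenge → Qubits n) × (Fin numHaar → Qubits n)) × Qubits anc)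
    (((Fin numChallenge → Qubits n) × (Fin numHaar → Qubits n)) × Qubits anc) ℂ
  isStarProjection_meas : IsStarProjection meas

/-- The probability that the non-adaptive adversary outputs `1`. -/
def NonadaptiveAdversary.acceptProb {n : ℕ} (𝒜 : NonadaptiveAdversary n) (W U : UnitaryOp n) : ℝ :=
  ∑ x, ‖(𝒜.meas *ᵥ
    (((tensorPow 𝒜.numChallenge (W : Matrix (Qubits n) (Qubits n) ℂ) ⊗ₖ
        tensorPow 𝒜.numHaar (U : Matrix (Qubits n) (Qubits n) ℂ)) ⊗ₖ
      (1 : Matrix (Qubits 𝒜.anc) (Qubits 𝒜.anc) ℂ)) *ᵥ 𝒜.init)) x‖ ^ 2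

/-- `ℓ`-query security as in `IsQuerySecurePRU`, against non-adaptive adversaries only. -/
def IsNonadaptivelyQuerySecurePRU (n ℓ : ℕ → ℕ) (G : OracleConstruction n) : Prop :=
  ∀ 𝒜 : ∀ lam, NonadaptiveAdversary (n lam),
    (∀ lam, (𝒜 lam).numChallenge ≤ ℓ lam) →
    (∃ p : Polynomial ℕ, ∀ lam, (𝒜 lam).numHaar ≤ p.eval lam) →
    ∃ ε, Negligible ε ∧ ∀ lam, advantage lam (G lam) (𝒜 lam).acceptProb ≤ ε lam

end HaarPRU

end

noncomputable section

namespace HaarPRU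

open scoped BigOperators

/-!
The operator `(B U A)^{⊗t} ⊗ U^{⊗p}` applied to half of a maximally entangled state produces the
Choi vector of `(B U A)^{⊗t} ⊗ U^{⊗p}`. For a fixed key these vectors lie in a subspace, spanned by
sandwiched copies of `Z^{⊗(t+p)}`, whose projection cannot tell which `t` of the `t + p` registers
received a copy of `V` once the others hold `U`. For independent `U` and `V` the
`(t + p).choose t` Choi vectors of such placements are nearly orthogonal, with inner products
controlled by the normalized trace of a Haar random unitary, so the projection of each of them onto
the subspace is of order `1 / (t + p).choose t`. A measurement that detects the sum of the
projections over all `2 ^ lam` keys accepts every keyed construction with probability at least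
`1 / 2`, and accepts an independent pair with probability at most about
`2 ^ lam / (t + p).choose t`. With `t = min ℓ lam` and `p` a large enough power of `lam`, the
binomial coefficient exceeds the number of keys.

The moments of the trace are bounded by conditioning on the unitary up to random signs of its rows,
which turns the trace into a sum with random signs. An adaptive adversary simulates the parallel
queries by moving one register after the other into its query register.
-/

/-! ### Random signs and the trace of a Haar random unitary -/

section RandomSigns

variable {ι : Type*} [Fintype ι] [DecidableEq ι]

lemma expect_exp_sum_sign_smul_le (a : ι → ℝ) :
    𝔼 ε : ι → ℤˣ, Real.exp (∑ i, ε i • a i) ≤ Real.exp ((∑ i, a i ^ 2) / 2) := by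
  have hcosh (x : ℝ) : ∑ u : ℤˣ, Real.exp (u • x) = 2 * Real.cosh x := by
    rw [UnitsInt.univ, Finset.sum_pair (by decide), Real.cosh_eq, one_smul, Units.neg_smul,
      one_smul]
    ring
  have hcard : Fintype.card (ι → ℤˣ) = 2 ^ Fintype.card ι := by simp
  calc 𝔼 ε : ι → ℤˣ, Real.exp (∑ i, ε i • a i)
      = (∏ i, 2 * Real.cosh (a i)) / 2 ^ Fintype.card ι := by
        simp_rw [Fintype.expect_eq_sum_div_card, Real.exp_sum, ← hcosh, hcard, Nat.cast_pow,
          Nat.cast_ofNat, Fintype.prod_sum]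
    _ = ∏ i, Real.cosh (a i) := by
        rw [Finset.prod_mul_distrib, Finset.prod_const, Finset.card_univ,
          mul_div_cancel_left₀ _ (by positivity)]
    _ ≤ ∏ i, Real.exp (a i ^ 2 / 2) := by
        gcongr
        exact Real.cosh_le_exp_half_sq _
    _ = Real.exp ((∑ i, a i ^ 2) / 2) := by rw [← Real.exp_sum, Finset.sum_div]

lemma expect_cosh_sum_sign_smul_le (a : ι → ℝ) :
    𝔼 ε : ι → ℤˣ, Real.cosh (∑ i, ε i • a i) ≤ Real.exp ((∑ i, a i ^ 2) / 2) := by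
  have hpos := expect_exp_sum_sign_smul_le a
  have hneg := expect_exp_sum_sign_smul_le fun i => -a i
  simp only [smul_neg, Finset.sum_neg_distrib, neg_sq] at hneg
  simp_rw [Real.cosh_eq, ← Finset.expect_div, Finset.expect_add_distrib]
  linarith

lemma exp_mul_norm_le_cosh_add_cosh (s : ℝ) (z : ℂ) :
    Real.exp (s * ‖z‖) ≤ Real.cosh (2 * s * z.re) + Real.cosh (2 * s * z.im) := by
  have exp_two_mul_abs_le (x : ℝ) : Real.exp |x| ^ 2 ≤ 2 * Real.cosh (2 * x) := by
    rw [← Real.cosh_abs, abs_mul, abs_two, Real.cosh_eq, ← Real.exp_nat_mul, Nat.cast_ofNat]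
    linarith [Real.exp_pos (-(2 * |x|))]
  have hnorm : s * ‖z‖ ≤ |s * z.re| + |s * z.im| := by
    rw [abs_mul, abs_mul, ← mul_add]
    exact mul_le_mul (le_abs_self s) (Complex.norm_le_abs_re_add_abs_im z) (norm_nonneg z)
      (abs_nonneg s)
  calc Real.exp (s * ‖z‖) ≤ Real.exp |s * z.re| * Real.exp |s * z.im| := by
        rw [← Real.exp_add]; exact Real.exp_le_exp.2 hnorm
    _ ≤ (Real.exp |s * z.re| ^ 2 + Real.exp |s * z.im| ^ 2) / 2 := by
        linarith [two_mul_le_add_sq (Real.exp |s * z.re|) (Real.exp |s * z.im|)]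
    _ ≤ Real.cosh (2 * s * z.re) + Real.cosh (2 * s * z.im) := by
        rw [mul_assoc, mul_assoc]
        linarith [exp_two_mul_abs_le (s * z.re), exp_two_mul_abs_le (s * z.im)]

lemma expect_exp_mul_norm_sum_sign_smul_le (s : ℝ) (a : ι → ℂ) :
    𝔼 ε : ι → ℤˣ, Real.exp (s * ‖∑ i, ε i • a i‖) ≤
      2 * Real.exp (2 * s ^ 2 * ∑ i, ‖a i‖ ^ 2) := by
  have component (f : ℂ →ₗ[ℝ] ℝ) (hf : ∀ z, |f z| ≤ ‖z‖) :
      𝔼 ε : ι → ℤˣ, Real.cosh (2 * s * f (∑ i, ε i • a i)) ≤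
        Real.exp (2 * s ^ 2 * ∑ i, ‖a i‖ ^ 2) := by
    have hlin (ε : ι → ℤˣ) : 2 * s * f (∑ i, ε i • a i) = ∑ i, ε i • (2 * s * f (a i)) := by
      simp only [map_sum, Units.smul_def, map_zsmul, Finset.mul_sum, mul_smul_comm]
    simp_rw [hlin]
    refine (expect_cosh_sum_sign_smul_le _).trans (Real.exp_le_exp.2 ?_)
    rw [Finset.sum_div, Finset.mul_sum]
    refine Finset.sum_le_sum fun i _ => ?_
    have hsq : f (a i) ^ 2 ≤ ‖a i‖ ^ 2 := sq_le_sq' (abs_le.1 (hf _)).1 (abs_le.1 (hf _)).2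
    nlinarith [mul_le_mul_of_nonneg_left hsq (sq_nonneg s)]
  calc 𝔼 ε : ι → ℤˣ, Real.exp (s * ‖∑ i, ε i • a i‖)
      ≤ 𝔼 ε : ι → ℤˣ, (Real.cosh (2 * s * Complex.reLm (∑ i, ε i • a i)) +
          Real.cosh (2 * s * Complex.imLm (∑ i, ε i • a i))) :=
        Finset.expect_le_expect fun ε _ => exp_mul_norm_le_cosh_add_cosh _ _
    _ ≤ 2 * Real.exp (2 * s ^ 2 * ∑ i, ‖a i‖ ^ 2) := by
        rw [Finset.expect_add_distrib, two_mul (Real.exp _)]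
        exact add_le_add (component Complex.reLm Complex.abs_re_le_norm)
          (component Complex.imLm Complex.abs_im_le_norm)

end RandomSigns

open MeasureTheory in
lemma integral_le_of_forall_expect_mul_left_le {G κ : Type*} [Group G] [MeasurableSpace G]
    [MeasurableMul G] {μ : Measure G} [IsProbabilityMeasure μ] [μ.IsMulLeftInvariant] [Fintype κ]
    [Nonempty κ] (g : κ → G) {f : G → ℝ} (hf : Integrable f μ) {C : ℝ}
    (hC : ∀ x, 𝔼 i, f (g i * x) ≤ C) : ∫ x, f x ∂μ ≤ C := by
  have hint (i : κ) : Integrable (fun x => f (g i * x)) μ := hf.comp_mul_left (g i)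
  calc ∫ x, f x ∂μ = ∫ x, 𝔼 i, f (g i * x) ∂μ := by
        simp_rw [Fintype.expect_eq_sum_div_card]
        rw [integral_div, integral_finsetSum _ fun i _ => hint i]
        simp_rw [integral_mul_left_eq_self]
        rw [Finset.sum_const, Finset.card_univ, nsmul_eq_mul,
          mul_div_cancel_left₀ _ (by positivity)]
    _ ≤ ∫ _, C ∂μ := by
        refine integral_mono ?_ (integrable_const C) hC
        simp_rw [Fintype.expect_eq_sum_div_card]
        exact (integrable_finsetSum _ fun i _ => hint i).div_const _
    _ = C := by simp

section Trace

variable {d : Type*} [Fintype d] [DecidableEq d]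

/-- The diagonal unitary matrix with prescribed entries `±1`. -/
def signUnitary (ε : d → ℤˣ) : Matrix.unitaryGroup d ℂ :=
  ⟨Matrix.diagonal fun i => ((ε i : ℤ) : ℂ), by
    simp [Matrix.mem_unitaryGroup_iff, Matrix.star_eq_conjTranspose,
      Matrix.diagonal_conjTranspose, Matrix.diagonal_mul_diagonal, ← Int.cast_mul, ← Units.val_mul,
      ← Matrix.diagonal_one]⟩

lemma trace_signUnitary_mul (ε : d → ℤˣ) (V : Matrix.unitaryGroup d ℂ) :
    (signUnitary ε * V).1.trace = ∑ i, ε i • V.1 i i := by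
  simp [signUnitary, Matrix.trace, Matrix.diagonal_mul, Units.smul_def]

lemma expect_exp_mul_norm_trace_signUnitary_mul_le (s : ℝ) (V : Matrix.unitaryGroup d ℂ) :
    𝔼 ε, Real.exp (s * ‖(signUnitary ε * V).1.trace‖) ≤
      2 * Real.exp (2 * s ^ 2 * Fintype.card d) := by
  simp_rw [trace_signUnitary_mul]
  refine (expect_exp_mul_norm_sum_sign_smul_le s _).trans ?_
  have hentries : ∑ i, ‖V.1 i i‖ ^ 2 ≤ Fintype.card d := by
    rw [← nsmul_one, ← Finset.card_univ]
    refine Finset.sum_le_card_nsmul _ _ _ fun i _ => ?_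
    exact pow_le_one₀ (norm_nonneg _) (entry_norm_bound_of_unitary V.2 i i)
  gcongr

end Trace

lemma integrable_of_continuous {n : ℕ} {f : UnitaryOp n → ℝ} (hf : Continuous f) :
    MeasureTheory.Integrable f (haarUnitary n) :=
  hf.integrable_of_hasCompactSupport (HasCompactSupport.of_compactSpace f)

lemma integral_exp_mul_norm_trace_le (n : ℕ) (s : ℝ) :
    ∫ V, Real.exp (s * ‖V.1.trace‖) ∂(haarUnitary n) ≤ 2 * Real.exp (2 * s ^ 2 * 2 ^ n) := by
  have hcont : Continuous fun V : UnitaryOp n => Real.exp (s * ‖V.1.trace‖) := by fun_prop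
  refine integral_le_of_forall_expect_mul_left_le signUnitary (integrable_of_continuous hcont)
    fun V => ?_
  simpa using expect_exp_mul_norm_trace_signUnitary_mul_le s V

lemma integral_one_add_norm_trace_pow_le (n m : ℕ) :
    ∫ V, (1 + ‖V.1.trace / 2 ^ n‖) ^ m ∂(haarUnitary n) ≤ 2 * Real.exp (2 * m ^ 2 / 2 ^ n) := by
  have hexp (V : UnitaryOp n) :
      (1 + ‖V.1.trace / 2 ^ n‖) ^ m ≤ Real.exp (m / 2 ^ n * ‖V.1.trace‖) := by
    rw [div_mul_eq_mul_div, mul_div_assoc, Real.exp_nat_mul, norm_div, norm_pow, Complex.norm_two,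
      add_comm]
    gcongr
    exact Real.add_one_le_exp _
  calc ∫ V, (1 + ‖V.1.trace / 2 ^ n‖) ^ m ∂(haarUnitary n)
      ≤ ∫ V, Real.exp (m / 2 ^ n * ‖V.1.trace‖) ∂(haarUnitary n) :=
        MeasureTheory.integral_mono (integrable_of_continuous (by fun_prop))
          (integrable_of_continuous (by fun_prop)) hexp
    _ ≤ 2 * Real.exp (2 * (m / 2 ^ n) ^ 2 * 2 ^ n) := integral_exp_mul_norm_trace_le n _
    _ = 2 * Real.exp (2 * m ^ 2 / 2 ^ n) := by congr 2; field_simp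

/-! ### Detecting membership in a union of subspaces -/

lemma exists_isStarProjection_smul_le_of_finite_spectrum {A : Type*} [Ring A] [StarRing A]
    [Algebra ℝ A] [PartialOrder A] [StarOrderedRing A] [TopologicalSpace A]
    [ContinuousFunctionalCalculus ℝ A IsSelfAdjoint] [NonnegSpectrumClass ℝ A] {a : A}
    (ha : 0 ≤ a) (hfin : (spectrum ℝ a).Finite) (c : ℝ) :
    ∃ p : A, IsStarProjection p ∧ c • p ≤ a ∧ (1 - p) * a * (1 - p) ≤ c • (1 - p) := by
  have hsa : IsSelfAdjoint a := ha.isSelfAdjoint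
  have hcont (f : ℝ → ℝ) : ContinuousOn f (spectrum ℝ a) := hfin.continuousOn f
  set χ : ℝ → ℝ := (Set.Ici c).indicator 1
  have hχ (x : ℝ) : χ x = 1 ∧ c ≤ x ∨ χ x = 0 ∧ x < c := by
    rcases le_or_gt c x with h | h
    · exact .inl ⟨Set.indicator_of_mem (Set.mem_Ici.2 h) _, h⟩
    · exact .inr ⟨Set.indicator_of_notMem (by simpa using h) _, h⟩
  have hcompl : 1 - cfc χ a = cfc (fun x => 1 - χ x) a := by
    rw [cfc_sub (fun _ => 1) χ a (hcont _) (hcont _), cfc_const_one ℝ a]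
  refine ⟨cfc χ a, ⟨?_, cfc_predicate χ a⟩, ?_, ?_⟩
  · rw [IsIdempotentElem, ← cfc_mul χ χ a (hcont _) (hcont _)]
    exact cfc_congr fun x _ => by rcases hχ x with ⟨h, _⟩ | ⟨h, _⟩ <;> simp [h]
  · rw [← cfc_smul c χ a (hcont _)]
    conv_rhs => rw [← cfc_id' ℝ a]
    refine cfc_mono (fun x hx => ?_) (hcont _) (hcont _)
    have hx0 : 0 ≤ x := spectrum_nonneg_of_nonneg ha hx
    rcases hχ x with ⟨h, hxc⟩ | ⟨h, _⟩ <;> simp_all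
  · rw [hcompl, ← cfc_smul c _ a (hcont _)]
    nth_rw 2 [← cfc_id' ℝ a]
    rw [← cfc_mul _ _ a (hcont _) (hcont _), ← cfc_mul _ _ a (hcont _) (hcont _)]
    refine cfc_mono (fun x _ => ?_) (hcont _) (hcont _)
    rcases hχ x with ⟨h, _⟩ | ⟨h, hxc⟩
    · simp [h]
    · simpa [h] using hxc.le

section Detector

lemma re_inner_apply_self_of_isStarProjection {𝕜 E : Type*} [RCLike 𝕜] [NormedAddCommGroup E]
    [InnerProductSpace 𝕜 E] [CompleteSpace E] {P : E →L[𝕜] E} (hP : IsStarProjection P) (x : E) :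
    RCLike.re (inner 𝕜 (P x) x) = ‖P x‖ ^ 2 := by
  have hidem : P (P x) = P x := DFunLike.congr_fun hP.isIdempotentElem x
  rw [← inner_self_eq_norm_sq (𝕜 := 𝕜), ← ContinuousLinearMap.adjoint_inner_left,
    hP.isSelfAdjoint.adjoint_eq, hidem]

lemma re_inner_apply_self_mono {𝕜 E : Type*} [RCLike 𝕜] [NormedAddCommGroup E]
    [InnerProductSpace 𝕜 E] {S T : E →L[𝕜] E} (hST : S ≤ T) (x : E) :
    RCLike.re (inner 𝕜 (S x) x) ≤ RCLike.re (inner 𝕜 (T x) x) := by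
  have h := ((ContinuousLinearMap.le_def S T).1 hST).re_inner_nonneg_left x
  rwa [sub_apply, inner_sub_left, map_sub, sub_nonneg] at h

lemma one_sub_mul_norm_sq_le_of_mem {𝕜 E : Type*} [RCLike 𝕜] [NormedAddCommGroup E]
    [InnerProductSpace 𝕜 E] [CompleteSpace E] {P : E →L[𝕜] E} (hP : IsStarProjection P)
    (K : Submodule 𝕜 E) [K.HasOrthogonalProjection] {c : ℝ} (hc : 0 ≤ c) {x : E} (hx : x ∈ K)
    (hPx : ‖K.starProjection ((1 - P) x)‖ ^ 2 ≤ c * ‖(1 - P) x‖ ^ 2) :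
    (1 - c) * ‖x‖ ^ 2 ≤ ‖P x‖ ^ 2 := by
  set y := (1 - P) x with hy
  have hinner : RCLike.re (inner 𝕜 y x) = ‖y‖ ^ 2 :=
    re_inner_apply_self_of_isStarProjection hP.one_sub x
  have hpythagoras : ‖x‖ ^ 2 = ‖P x‖ ^ 2 + ‖y‖ ^ 2 := by
    rw [← hinner, ← re_inner_apply_self_of_isStarProjection hP x, ← map_add, ← inner_add_left, hy,
      sub_apply, one_apply_eq_self, add_sub_cancel,
      inner_self_eq_norm_sq]
  have hcauchy : ‖y‖ ^ 2 ≤ ‖K.starProjection y‖ * ‖x‖ := by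
    rw [← hinner, ← Submodule.starProjection_eq_self_iff.2 hx,
      ← K.inner_starProjection_left_eq_right, Submodule.starProjection_eq_self_iff.2 hx]
    exact re_inner_le_norm _ _
  have hy_le : ‖y‖ ^ 2 ≤ c * ‖x‖ ^ 2 := by
    rcases (sq_nonneg ‖y‖).eq_or_lt with h0 | hpos
    · rw [← h0]
      positivity
    · refine le_of_mul_le_mul_right ?_ hpos
      calc ‖y‖ ^ 2 * ‖y‖ ^ 2 ≤ (‖K.starProjection y‖ * ‖x‖) ^ 2 := by
            rw [← sq]; exact pow_le_pow_left₀ hpos.le hcauchy 2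
        _ = ‖K.starProjection y‖ ^ 2 * ‖x‖ ^ 2 := mul_pow _ _ _
        _ ≤ c * ‖y‖ ^ 2 * ‖x‖ ^ 2 := by gcongr
        _ = c * ‖x‖ ^ 2 * ‖y‖ ^ 2 := by ring
  linarith

lemma finite_real_spectrum_of_finiteDimensional {E : Type*} [NormedAddCommGroup E]
    [NormedSpace ℂ E] [FiniteDimensional ℂ E] (T : E →L[ℂ] E) : (spectrum ℝ T).Finite := by
  have h : (spectrum ℂ T).Finite := by
    rw [← AlgEquiv.spectrum_eq (Module.End.toContinuousLinearMap E).symm T]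
    exact Module.End.finite_spectrum _
  rw [← spectrum.preimage_algebraMap ℂ]
  exact h.preimage (FaithfulSMul.algebraMap_injective ℝ ℂ).injOn

theorem exists_detector {E κ : Type*} [NormedAddCommGroup E] [InnerProductSpace ℂ E]
    [FiniteDimensional ℂ E] [Fintype κ] (K : κ → Submodule ℂ E) {c : ℝ} (hc : 0 ≤ c) :
    ∃ P : E →L[ℂ] E, IsStarProjection P ∧
      (∀ k, ∀ x ∈ K k, (1 - c) * ‖x‖ ^ 2 ≤ ‖P x‖ ^ 2) ∧
      ∀ x, c * ‖P x‖ ^ 2 ≤ ∑ k, ‖(K k).starProjection x‖ ^ 2 := by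
  have := FiniteDimensional.complete ℂ E
  set T : E →L[ℂ] E := ∑ k, (K k).starProjection
  have hT (x : E) : RCLike.re (inner ℂ (T x) x) = ∑ k, ‖(K k).starProjection x‖ ^ 2 := by
    simp only [T, sum_apply, sum_inner, map_sum,
      re_inner_apply_self_of_isStarProjection isStarProjection_starProjection]
  have hT0 : 0 ≤ T := Finset.sum_nonneg fun k _ => isStarProjection_starProjection.nonneg
  obtain ⟨P, hP, hPT, hTP⟩ := exists_isStarProjection_smul_le_of_finite_spectrum hT0
    (finite_real_spectrum_of_finiteDimensional T) c
  have smul_re (Q : E →L[ℂ] E) (hQ : IsStarProjection Q) (x : E) :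
      RCLike.re (inner ℂ ((c • Q) x) x) = c * ‖Q x‖ ^ 2 := by
    rw [← re_inner_apply_self_of_isStarProjection hQ, smul_apply,
      inner_smul_left_eq_smul, RCLike.smul_re]
  refine ⟨P, hP, fun k x hx => ?_, fun x => ?_⟩
  · refine one_sub_mul_norm_sq_le_of_mem hP (K k) hc hx ?_
    calc ‖(K k).starProjection ((1 - P) x)‖ ^ 2
        ≤ ∑ k, ‖(K k).starProjection ((1 - P) x)‖ ^ 2 :=
          Finset.single_le_sum (f := fun k => ‖(K k).starProjection ((1 - P) x)‖ ^ 2)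
            (fun _ _ => by positivity) (Finset.mem_univ k)
      _ = RCLike.re (inner ℂ (((1 - P) * T * (1 - P)) x) x) := by
          rw [← hT, mul_apply_eq_comp, mul_apply_eq_comp,
            ← ContinuousLinearMap.adjoint_inner_right (1 - P), hP.one_sub.isSelfAdjoint.adjoint_eq]
      _ ≤ c * ‖(1 - P) x‖ ^ 2 :=
          (re_inner_apply_self_mono hTP x).trans_eq (smul_re _ hP.one_sub x)
  · rw [← smul_re P hP, ← hT]
    exact re_inner_apply_self_mono hPT x

theorem exists_matrix_detector {ι κ : Type*} [Fintype ι] [Fintype κ]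
    (K : κ → Submodule ℂ (EuclideanSpace ℂ ι)) {c : ℝ} (hc : 0 ≤ c) :
    ∃ M : Matrix ι ι ℂ, IsStarProjection M ∧
      (∀ k, ∀ x ∈ K k, (1 - c) * ‖x‖ ^ 2 ≤ ∑ i, ‖(M *ᵥ x.ofLp) i‖ ^ 2) ∧
      ∀ x, c * ∑ i, ‖(M *ᵥ x.ofLp) i‖ ^ 2 ≤ ∑ k, ‖(K k).starProjection x‖ ^ 2 := by
  classical
  obtain ⟨P, hP, hK, hP_le⟩ := exists_detector K hc
  let φ := Matrix.toEuclideanCLM (n := ι) (𝕜 := ℂ)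
  have hφ (x : EuclideanSpace ℂ ι) : ∑ i, ‖(φ.symm P *ᵥ x.ofLp) i‖ ^ 2 = ‖P x‖ ^ 2 := by
    rw [← Matrix.ofLp_toEuclideanCLM, ← EuclideanSpace.norm_sq_eq, φ.apply_symm_apply]
  have hselfAdjoint : IsSelfAdjoint (φ.symm P) :=
    (map_star φ.symm P).symm.trans (congrArg φ.symm hP.isSelfAdjoint)
  refine ⟨φ.symm P, ⟨hP.isIdempotentElem.map φ.symm, hselfAdjoint⟩, ?_, ?_⟩
  · simpa only [hφ] using hK
  · simpa only [hφ] using hP_le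

end Detector

/-! ### Projections of nearly orthogonal exchangeable families -/

section Exchangeable

variable {𝕜 E ι : Type*} [RCLike 𝕜] [NormedAddCommGroup E] [InnerProductSpace 𝕜 E]

lemma card_mul_norm_starProjection_le_norm_sum (K : Submodule 𝕜 E) [K.HasOrthogonalProjection]
    {s : Finset ι} {v : ι → E} {j : ι} (hv : ∀ i ∈ s, v i - v j ∈ Kᗮ) :
    s.card * ‖K.starProjection (v j)‖ ≤ ‖∑ i ∈ s, v i‖ := by
  have hproj : ∀ i ∈ s, K.starProjection (v i) = K.starProjection (v j) := fun i hi => by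
    rw [← sub_eq_zero, ← map_sub, K.starProjection_apply_eq_zero_iff]
    exact hv i hi
  calc s.card * ‖K.starProjection (v j)‖ = ‖K.starProjection (∑ i ∈ s, v i)‖ := by
        rw [map_sum, Finset.sum_congr rfl hproj, Finset.sum_const, ← Nat.cast_smul_eq_nsmul 𝕜,
          norm_smul, RCLike.norm_natCast]
    _ ≤ ‖∑ i ∈ s, v i‖ := K.norm_starProjection_apply_le _

lemma norm_sum_sq_le_card_mul {s : Finset ι} {v : ι → E} {R : ℝ}
    (hR : ∀ i ∈ s, ∑ j ∈ s, ‖inner 𝕜 (v i) (v j)‖ ≤ R) : ‖∑ i ∈ s, v i‖ ^ 2 ≤ s.card * R := by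
  calc ‖∑ i ∈ s, v i‖ ^ 2 = ‖∑ i ∈ s, ∑ j ∈ s, inner 𝕜 (v i) (v j)‖ := by
        simp_rw [← inner_sum, ← sum_inner, inner_self_eq_norm_sq_to_K, norm_pow, norm_algebraMap',
          norm_norm]
    _ ≤ ∑ i ∈ s, ∑ j ∈ s, ‖inner 𝕜 (v i) (v j)‖ :=
        (norm_sum_le _ _).trans (Finset.sum_le_sum fun i _ => norm_sum_le _ _)
    _ ≤ s.card * R := by
        rw [← nsmul_eq_mul]
        exact Finset.sum_le_card_nsmul _ _ _ hR

lemma norm_starProjection_sq_le_div_card (K : Submodule 𝕜 E) [K.HasOrthogonalProjection]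
    {s : Finset ι} {v : ι → E} {j : ι} (hs : s.Nonempty) (hv : ∀ i ∈ s, v i - v j ∈ Kᗮ) {R : ℝ}
    (hR : ∀ i ∈ s, ∑ j ∈ s, ‖inner 𝕜 (v i) (v j)‖ ≤ R) :
    ‖K.starProjection (v j)‖ ^ 2 ≤ R / s.card := by
  have hcard : (0 : ℝ) < s.card := by exact_mod_cast hs.card_pos
  rw [le_div_iff₀ hcard]
  refine le_of_mul_le_mul_left ?_ hcard
  calc s.card * (‖K.starProjection (v j)‖ ^ 2 * s.card)
      = (s.card * ‖K.starProjection (v j)‖) ^ 2 := by ring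
    _ ≤ ‖∑ i ∈ s, v i‖ ^ 2 := by
        gcongr
        exact card_mul_norm_starProjection_le_norm_sum K hv
    _ ≤ s.card * R := norm_sum_sq_le_card_mul hR

lemma sum_pow_card_symmDiff [Fintype ι] [DecidableEq ι] {R : Type*} [CommSemiring R] (r : R)
    (S : Finset ι) :
    ∑ T : Finset ι, r ^ (symmDiff S T).card = (1 + r) ^ Fintype.card ι := by
  have h := Fintype.sum_pow_mul_eq_add_pow ι r 1
  simp only [one_pow, mul_one] at h
  rw [add_comm 1 r, ← h]
  exact Equiv.sum_comp (symmDiff_right_involutive S).toPerm fun D => r ^ D.card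

theorem norm_starProjection_sq_le_div_choose [Fintype ι] [DecidableEq ι] (K : Submodule 𝕜 E)
    [K.HasOrthogonalProjection] {v : Finset ι → E} {r : ℝ} (hr : 0 ≤ r)
    (hv : ∀ S T : Finset ι, S.card = T.card → v S - v T ∈ Kᗮ)
    (hvr : ∀ S T, ‖inner 𝕜 (v S) (v T)‖ ≤ r ^ (symmDiff S T).card) (T : Finset ι) :
    ‖K.starProjection (v T)‖ ^ 2 ≤
      (1 + r) ^ Fintype.card ι / (Fintype.card ι).choose T.card := by
  set 𝒮 := (Finset.univ : Finset ι).powersetCard T.card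
  have hcard : 𝒮.card = (Fintype.card ι).choose T.card := by
    rw [Finset.card_powersetCard, Finset.card_univ]
  rw [← hcard]
  refine norm_starProjection_sq_le_div_card (𝕜 := 𝕜) K ⟨T, by simp⟩
    (fun S hS => hv S T (Finset.mem_powersetCard.1 hS).2) fun S _ => ?_
  calc ∑ S' ∈ 𝒮, ‖inner 𝕜 (v S) (v S')‖ ≤ ∑ S' ∈ 𝒮, r ^ (symmDiff S S').card :=
        Finset.sum_le_sum fun S' _ => hvr S S'
    _ ≤ ∑ S', r ^ (symmDiff S S').card :=
        Finset.sum_le_univ_sum_of_nonneg fun _ => pow_nonneg hr _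
    _ = (1 + r) ^ Fintype.card ι := sum_pow_card_symmDiff r S

end Exchangeable

/-! ### Overlaps, tensor products and Choi vectors -/

section Overlap

variable {d : Type*} [Fintype d]

/-- The normalized Hilbert-Schmidt inner product `tr (Mᴴ N) / d`, which is the inner product of the
Choi vectors of `M` and `N`. -/
def overlap (M N : Matrix d d ℂ) : ℂ :=
  (Mᴴ * N).trace / Fintype.card d

lemma norm_overlap_comm (M N : Matrix d d ℂ) : ‖overlap M N‖ = ‖overlap N M‖ := by
  rw [overlap, overlap, norm_div, norm_div, ← norm_star (Mᴴ * N).trace,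
    ← Matrix.trace_conjTranspose, Matrix.conjTranspose_mul, Matrix.conjTranspose_conjTranspose]

lemma overlap_mul_mul (B M A N : Matrix d d ℂ) :
    overlap (B * M * A) N = overlap M (Bᴴ * N * Aᴴ) := by
  rw [overlap, overlap, Matrix.conjTranspose_mul, Matrix.conjTranspose_mul, Matrix.mul_assoc,
    Matrix.trace_mul_comm]
  simp only [Matrix.mul_assoc]

variable [DecidableEq d]

lemma overlap_self_of_mem_unitaryGroup [Nonempty d] {M : Matrix d d ℂ}
    (hM : M ∈ Matrix.unitaryGroup d ℂ) : overlap M M = 1 := by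
  rw [overlap, ← Matrix.star_eq_conjTranspose, Unitary.star_mul_self_of_mem hM, Matrix.trace_one,
    div_self (Nat.cast_ne_zero.2 Fintype.card_ne_zero)]

lemma overlap_unitary_mul_mul_unitary (A B : Matrix.unitaryGroup d ℂ) (M N : Matrix d d ℂ) :
    overlap (B.1 * M * A.1) (B.1 * N * A.1) = overlap M N := by
  have hB : B.1ᴴ * B.1 = 1 := Unitary.coe_star_mul_self B
  have hA : A.1 * A.1ᴴ = 1 := Unitary.coe_mul_star_self A
  rw [overlap_mul_mul, Matrix.mul_assoc B.1, ← Matrix.mul_assoc, hB, Matrix.one_mul,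
    Matrix.mul_assoc, hA, Matrix.mul_one]

end Overlap

section TensorOp

variable {σ τ d R : Type*} [Fintype σ] [Fintype τ] [CommRing R]

/-- The tensor product `⨂ i, O i` of operators on registers indexed by `σ`. -/
def tensorOp (O : σ → Matrix d d R) : Matrix (σ → d) (σ → d) R :=
  Matrix.of fun x y => ∏ i, O i (x i) (y i)

lemma tensorOp_apply (O : σ → Matrix d d R) (x y : σ → d) :
    tensorOp O x y = ∏ i, O i (x i) (y i) := rfl

lemma tensorOp_conjTranspose [StarRing R] (O : σ → Matrix d d R) :
    (tensorOp O)ᴴ = tensorOp fun i => (O i)ᴴ := by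
  ext x y
  simp only [Matrix.conjTranspose_apply, tensorOp_apply, star_prod]

lemma tensorOp_mul [DecidableEq σ] [Fintype d] (O P : σ → Matrix d d R) :
    tensorOp O * tensorOp P = tensorOp fun i => O i * P i := by
  ext x y
  simp only [tensorOp_apply, Matrix.mul_apply, ← Finset.prod_mul_distrib, Fintype.prod_sum]

lemma trace_tensorOp [DecidableEq σ] [Fintype d] (O : σ → Matrix d d R) :
    (tensorOp O).trace = ∏ i, (O i).trace := by
  simp only [Matrix.trace, Matrix.diag_apply, tensorOp_apply, Fintype.prod_sum]

lemma overlap_tensorOp [DecidableEq σ] [Fintype d] (X Y : σ → Matrix d d ℂ) :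
    overlap (tensorOp X) (tensorOp Y) = ∏ i, overlap (X i) (Y i) := by
  simp [overlap, tensorOp_conjTranspose, tensorOp_mul, trace_tensorOp, Finset.prod_div_distrib]

lemma tensorOp_sumElim (O : σ → Matrix d d R) (P : τ → Matrix d d R) :
    tensorOp (Sum.elim O P) = (tensorOp O ⊗ₖ tensorOp P).submatrix
      (Equiv.sumArrowEquivProdArrow σ τ d) (Equiv.sumArrowEquivProdArrow σ τ d) := by
  ext x y
  simp [tensorOp_apply]

variable [DecidableEq d]

lemma tensorOp_one : tensorOp (fun _ : σ => (1 : Matrix d d R)) = 1 := by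
  classical
  ext x y
  simp only [tensorOp_apply, Matrix.one_apply, Fintype.prod_ite_zero, Finset.prod_const_one,
    ← funext_iff]

lemma tensorOp_mem_unitaryGroup [Fintype d] [DecidableEq σ] [StarRing R] {O : σ → Matrix d d R}
    (hO : ∀ i, O i ∈ Matrix.unitaryGroup d R) :
    tensorOp O ∈ Matrix.unitaryGroup (σ → d) R := by
  rw [Matrix.mem_unitaryGroup_iff, Matrix.star_eq_conjTranspose, tensorOp_conjTranspose,
    tensorOp_mul, ← tensorOp_one]
  exact congrArg tensorOp (funext fun i => Matrix.mem_unitaryGroup_iff.1 (hO i))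

end TensorOp

section ChoiVector

variable {d : Type*} [Fintype d]

/-- The Choi vector `(M ⊗ 1) ∑ i, |i⟩ ⊗ |i⟩ / √d` of the operator `M`. -/
def choiVector (M : Matrix d d ℂ) : EuclideanSpace ℂ (d × d) :=
  WithLp.toLp 2 (((√(Fintype.card d) : ℝ) : ℂ)⁻¹ • Mᵀ.vec)

lemma inner_choiVector (M N : Matrix d d ℂ) :
    inner ℂ (choiVector M) (choiVector N) = overlap M N := by
  have hnormalization : (((√(Fintype.card d) : ℝ) : ℂ)⁻¹) * ((√(Fintype.card d) : ℝ) : ℂ)⁻¹ =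
      (Fintype.card d : ℂ)⁻¹ := by
    rw [← mul_inv, ← Complex.ofReal_mul, Real.mul_self_sqrt (Nat.cast_nonneg _),
      Complex.ofReal_natCast]
  rw [choiVector, choiVector, EuclideanSpace.inner_toLp_toLp, star_smul, smul_dotProduct,
    dotProduct_smul, dotProduct_comm, Matrix.star_vec_dotProduct_vec, smul_smul, star_inv₀,
    RCLike.star_def, Complex.conj_ofReal, hnormalization, smul_eq_mul, overlap,
    div_eq_inv_mul, ← Matrix.trace_transpose, Matrix.transpose_mul, Matrix.transpose_transpose,
    Matrix.trace_mul_comm]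
  rfl

lemma kronecker_one_mulVec_choiVector [DecidableEq d] (M N : Matrix d d ℂ) :
    (M ⊗ₖ (1 : Matrix d d ℂ)) *ᵥ (choiVector N).ofLp = (choiVector (M * N)).ofLp := by
  simp only [choiVector, Matrix.mulVec_smul, Matrix.kronecker_mulVec_vec, Matrix.one_mul,
    Matrix.transpose_mul]

lemma norm_choiVector_of_mem_unitaryGroup [DecidableEq d] [Nonempty d] {M : Matrix d d ℂ}
    (hM : M ∈ Matrix.unitaryGroup d ℂ) : ‖choiVector M‖ = 1 := by
  rw [← sq_eq_sq₀ (norm_nonneg _) zero_le_one, ← inner_self_eq_norm_sq (𝕜 := ℂ), inner_choiVector,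
    overlap_self_of_mem_unitaryGroup hM, RCLike.one_re, one_pow]

end ChoiVector

/-! ### Sandwiched Choi vectors -/

section Sandwich

variable {σ d : Type*} [Fintype σ] [DecidableEq σ] [Fintype d] [DecidableEq d]

/-- The tensor product of the sandwiches `B i * X i * A i`. -/
def sandwich (A B : σ → Matrix.unitaryGroup d ℂ) (X : σ → Matrix d d ℂ) :
    Matrix (σ → d) (σ → d) ℂ :=
  tensorOp fun i => (B i).1 * X i * (A i).1

lemma overlap_sandwich (A B : σ → Matrix.unitaryGroup d ℂ) (X Y : σ → Matrix d d ℂ) :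
    overlap (sandwich A B X) (sandwich A B Y) = ∏ i, overlap (X i) (Y i) := by
  simp only [sandwich, overlap_tensorOp, overlap_unitary_mul_mul_unitary]

/-- The span of the Choi vectors obtained by sandwiching the same unitary in every register. -/
def sandwichSpan (A B : σ → Matrix.unitaryGroup d ℂ) :
    Submodule ℂ (EuclideanSpace ℂ ((σ → d) × (σ → d))) :=
  Submodule.span ℂ (Set.range fun Z : Matrix.unitaryGroup d ℂ =>
    choiVector (sandwich A B fun _ => Z.1))

lemma choiVector_sandwich_sub_mem_orthogonal (A B : σ → Matrix.unitaryGroup d ℂ)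
    (U V : Matrix d d ℂ) {S T : Finset σ} (hST : S.card = T.card) :
    choiVector (sandwich A B fun i => if i ∈ S then V else U) -
      choiVector (sandwich A B fun i => if i ∈ T then V else U) ∈ (sandwichSpan A B)ᗮ := by
  have hinner (Z : Matrix d d ℂ) (S : Finset σ) : ∏ i, overlap Z (if i ∈ S then V else U) =
      overlap Z V ^ S.card * overlap Z U ^ (Fintype.card σ - S.card) := by
    rw [← Finset.prod_mul_prod_compl S, ← Finset.card_compl]
    congr 1
    · exact Finset.prod_eq_pow_card fun i hi => by rw [if_pos hi]
    · exact Finset.prod_eq_pow_card fun i hi => by rw [if_neg (Finset.mem_compl.1 hi)]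
  rw [sandwichSpan, Submodule.mem_orthogonal]
  intro x hx
  induction hx using Submodule.span_induction with
  | mem x hx =>
    obtain ⟨Z, rfl⟩ := hx
    simp only [inner_sub_right, inner_choiVector, overlap_sandwich, hinner, hST, sub_self]
  | zero => exact inner_zero_left _
  | add x y _ _ hx hy => rw [inner_add_left, hx, hy, add_zero]
  | smul a x _ hx => rw [inner_smul_left, hx, mul_zero]

lemma norm_overlap_sandwich_ite (A B : σ → Matrix.unitaryGroup d ℂ) [Nonempty d]
    (U V : Matrix.unitaryGroup d ℂ) (S T : Finset σ) :
    ‖overlap (sandwich A B fun i => if i ∈ S then V.1 else U.1)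
      (sandwich A B fun i => if i ∈ T then V.1 else U.1)‖ =
      ‖overlap U.1 V.1‖ ^ (symmDiff S T).card := by
  have hU : overlap U.1 U.1 = 1 := overlap_self_of_mem_unitaryGroup U.2
  have hV : overlap V.1 V.1 = 1 := overlap_self_of_mem_unitaryGroup V.2
  have hfactor (i : σ) : ‖overlap (if i ∈ S then V.1 else U.1) (if i ∈ T then V.1 else U.1)‖ =
      if i ∈ symmDiff S T then ‖overlap U.1 V.1‖ else 1 := by
    by_cases hS : i ∈ S <;> by_cases hT : i ∈ T <;>
      simp [hS, hT, hU, hV, Finset.mem_symmDiff, norm_overlap_comm V.1 U.1]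
  simp only [overlap_sandwich, norm_prod, hfactor, Finset.prod_ite_mem, Finset.univ_inter,
    Finset.prod_const]

theorem norm_starProjection_sandwichSpan_sq_le [Nonempty d] (A B : σ → Matrix.unitaryGroup d ℂ)
    (U V : Matrix.unitaryGroup d ℂ) (T : Finset σ) :
    ‖(sandwichSpan A B).starProjection
        (choiVector (sandwich A B fun i => if i ∈ T then V.1 else U.1))‖ ^ 2 ≤
      (1 + ‖overlap U.1 V.1‖) ^ Fintype.card σ / (Fintype.card σ).choose T.card := by
  refine norm_starProjection_sq_le_div_choose (sandwichSpan A B)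
    (v := fun T => choiVector (sandwich A B fun i => if i ∈ T then V.1 else U.1)) (norm_nonneg _)
    (fun S T => choiVector_sandwich_sub_mem_orthogonal A B U.1 V.1) (fun S T => ?_) T
  rw [inner_choiVector, norm_overlap_sandwich_ite]

end Sandwich

/-! ### The non-adaptive distinguisher -/

section Submatrix

variable {m n : Type*} [Fintype m] [Fintype n]

lemma isStarProjection_submatrix_equiv {M : Matrix m m ℂ} (hM : IsStarProjection M) (e : n ≃ m) :
    IsStarProjection (M.submatrix e e) := by
  refine ⟨?_, ?_⟩
  · rw [IsIdempotentElem, Matrix.submatrix_mul_equiv, hM.isIdempotentElem.eq]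
  · rw [isSelfAdjoint_iff, Matrix.star_eq_conjTranspose, Matrix.conjTranspose_submatrix,
      ← Matrix.star_eq_conjTranspose, hM.isSelfAdjoint.star_eq]

end Submatrix

section NonadaptiveDistinguisher

variable {n : ℕ}

/-- The identification of the challenge and Haar registers with one family of registers, together
with a relabelling `f` of the ancillas. -/
def registerEquiv (n t p : ℕ) {α β : Type*} (f : α ≃ β) :
    ((Fin t → Qubits n) × (Fin p → Qubits n)) × α ≃ (Fin t ⊕ Fin p → Qubits n) × β :=
  (Equiv.sumArrowEquivProdArrow _ _ _).symm.prodCongr f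

lemma tensorPow_kronecker_eq_submatrix (t p : ℕ) {α β : Type*} [DecidableEq α] [DecidableEq β]
    (f : α ≃ β) (W U : Matrix (Qubits n) (Qubits n) ℂ) :
    (tensorPow t W ⊗ₖ tensorPow p U) ⊗ₖ (1 : Matrix α α ℂ) =
      (tensorOp (Sum.elim (fun _ : Fin t => W) fun _ : Fin p => U) ⊗ₖ (1 : Matrix β β ℂ)).submatrix
        (registerEquiv n t p f) (registerEquiv n t p f) := by
  ext x y
  simp [tensorOp_sumElim, tensorPow, tensorOp_apply, registerEquiv, Matrix.one_apply]

lemma acceptProb_eq_sum_tensorOp (𝒜 : NonadaptiveAdversary n) {β : Type*} [Fintype β]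
    [DecidableEq β] (f : Qubits 𝒜.anc ≃ β) (W U : UnitaryOp n) :
    let e := registerEquiv n 𝒜.numChallenge 𝒜.numHaar f
    𝒜.acceptProb W U = ∑ x, ‖(𝒜.meas.submatrix e.symm e.symm *ᵥ
      ((tensorOp (Sum.elim (fun _ => W.1) fun _ => U.1) ⊗ₖ (1 : Matrix β β ℂ)) *ᵥ
        (𝒜.init ∘ e.symm))) x‖ ^ 2 := by
  intro e
  simp only [NonadaptiveAdversary.acceptProb, tensorPow_kronecker_eq_submatrix _ _ f,
    Matrix.submatrix_mulVec_equiv]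
  exact (e.symm.sum_comp fun x => ‖(𝒜.meas *ᵥ _) x‖ ^ 2).symm

lemma exists_nonadaptiveAdversary_acceptProb_eq (t p : ℕ)
    {P : Matrix ((Fin t ⊕ Fin p → Qubits n) × (Fin t ⊕ Fin p → Qubits n))
      ((Fin t ⊕ Fin p → Qubits n) × (Fin t ⊕ Fin p → Qubits n)) ℂ} (hP : IsStarProjection P) :
    ∃ 𝒜 : NonadaptiveAdversary n, 𝒜.numChallenge = t ∧ 𝒜.numHaar = p ∧ ∀ W U,
      𝒜.acceptProb W U = ∑ x, ‖(P *ᵥ (choiVector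
        (tensorOp (Sum.elim (fun _ : Fin t => W.1) fun _ : Fin p => U.1))).ofLp) x‖ ^ 2 := by
  have hcard : Fintype.card (Qubits (n * (t + p))) =
      Fintype.card (Fin t ⊕ Fin p → Qubits n) := by
    simp [pow_mul]
  let f := Fintype.equivOfCardEq hcard
  let e := registerEquiv n t p f
  let ψ := choiVector (1 : Matrix (Fin t ⊕ Fin p → Qubits n) _ ℂ)
  have hψ : ‖ψ‖ = 1 := norm_choiVector_of_mem_unitaryGroup (one_mem _)
  have hinit : ∑ x, ‖(ψ.ofLp ∘ e) x‖ ^ 2 = 1 := by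
    simp only [Function.comp_apply]
    rw [e.sum_comp fun x => ‖ψ.ofLp x‖ ^ 2, ← EuclideanSpace.norm_sq_eq, hψ, one_pow]
  refine ⟨⟨t, p, n * (t + p), ψ.ofLp ∘ e, hinit, P.submatrix e e,
    isStarProjection_submatrix_equiv hP e⟩, rfl, rfl, fun W U => ?_⟩
  rw [acceptProb_eq_sum_tensorOp _ f, Matrix.submatrix_submatrix, Function.comp_assoc]
  simp only [e, Equiv.self_comp_symm, Function.comp_id, Matrix.submatrix_id_id, ψ,
    kronecker_one_mulVec_choiVector, Matrix.mul_one]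

/-- The span of the Choi vectors of `t` copies of `B * U * A` and `p` copies of `U`. -/
def constructionSpan (t p : ℕ) (A B : UnitaryOp n) :
    Submodule ℂ (EuclideanSpace ℂ ((Fin t ⊕ Fin p → Qubits n) × (Fin t ⊕ Fin p → Qubits n))) :=
  sandwichSpan (Sum.elim (fun _ => A) fun _ => 1) (Sum.elim (fun _ => B) fun _ => 1)

lemma tensorOp_sumElim_eq_sandwich {t p : ℕ} (A B U V : UnitaryOp n) :
    tensorOp (Sum.elim (fun _ : Fin t => (B * V * A).1) fun _ : Fin p => U.1) =
      sandwich (Sum.elim (fun _ => A) fun _ => 1) (Sum.elim (fun _ => B) fun _ => 1)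
        fun i => if i ∈ Finset.univ.map Function.Embedding.inl then V.1 else U.1 := by
  refine congrArg tensorOp (funext fun i => ?_)
  cases i <;> simp

lemma choiVector_mem_constructionSpan {t p : ℕ} (A B U : UnitaryOp n) :
    choiVector (tensorOp (Sum.elim (fun _ : Fin t => (B * U * A).1) fun _ : Fin p => U.1)) ∈
      constructionSpan t p A B := by
  rw [tensorOp_sumElim_eq_sandwich]
  simp only [ite_self]
  exact Submodule.subset_span ⟨U, rfl⟩

lemma norm_starProjection_constructionSpan_sq_le {t p : ℕ} (A B U V : UnitaryOp n) :
    ‖(constructionSpan t p A B).starProjection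
        (choiVector (tensorOp (Sum.elim (fun _ : Fin t => V.1) fun _ : Fin p => U.1)))‖ ^ 2 ≤
      (1 + ‖overlap (B * U * A).1 V.1‖) ^ (t + p) / (t + p).choose t := by
  obtain ⟨V, rfl⟩ : ∃ V', V = B * V' * A := ⟨B⁻¹ * V * A⁻¹, by group⟩
  have h := norm_starProjection_sandwichSpan_sq_le
    (Sum.elim (fun _ : Fin t => A) fun _ : Fin p => 1)
    (Sum.elim (fun _ : Fin t => B) fun _ : Fin p => 1) U V (Finset.univ.map Function.Embedding.inl)
  rw [← tensorOp_sumElim_eq_sandwich, ← overlap_unitary_mul_mul_unitary A B] at h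
  simpa [constructionSpan] using h

lemma integral_one_add_norm_overlap_pow_le (m : ℕ) (X : UnitaryOp n) :
    ∫ V : UnitaryOp n, (1 + ‖overlap X.1 V.1‖) ^ m ∂(haarUnitary n) ≤
      2 * Real.exp (2 * m ^ 2 / 2 ^ n) := by
  have hoverlap (V : UnitaryOp n) : overlap X.1 V.1 = (X⁻¹ * V).1.trace / 2 ^ n := by
    simp [overlap, Matrix.star_eq_conjTranspose]
  simp only [hoverlap]
  rw [MeasureTheory.integral_mul_left_eq_self
    fun V : UnitaryOp n => (1 + ‖V.1.trace / 2 ^ n‖) ^ m]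
  exact integral_one_add_norm_trace_pow_le n m

lemma sub_le_advantage {lam : ℕ} {G : Qubits lam → UnitaryOp n → UnitaryOp n}
    {acc : UnitaryOp n → UnitaryOp n → ℝ} {a b : ℝ} (hacc : ∀ W U, 0 ≤ acc W U)
    (hreal : ∀ k, a ≤ ∫ U, acc (G k U) U ∂(haarUnitary n))
    (hideal : ∀ U, ∫ V, acc V U ∂(haarUnitary n) ≤ b) : a - b ≤ advantage lam G acc := by
  have hmean : a ≤ (∑ k, ∫ U, acc (G k U) U ∂(haarUnitary n)) / 2 ^ lam := by
    have hsum := Finset.card_nsmul_le_sum Finset.univ _ a fun k _ => hreal k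
    rw [le_div_iff₀ (by positivity), mul_comm]
    simpa using hsum
  have hmean' : ∫ U, ∫ V, acc V U ∂(haarUnitary n) ∂(haarUnitary n) ≤ b := by
    have hint := MeasureTheory.integral_mono_of_nonneg (μ := haarUnitary n)
      (.of_forall fun U => MeasureTheory.integral_nonneg fun V => hacc V U)
      (MeasureTheory.integrable_const b) (.of_forall hideal)
    simpa using hint
  exact (sub_le_sub hmean hmean').trans (le_abs_self _)

lemma acceptProb_nonneg (𝒜 : NonadaptiveAdversary n) (W U : UnitaryOp n) :
    0 ≤ 𝒜.acceptProb W U :=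
  Finset.sum_nonneg fun _ _ => by positivity

lemma continuous_acceptProb (𝒜 : NonadaptiveAdversary n) {X : Type*} [TopologicalSpace X]
    {W U : X → UnitaryOp n} (hW : Continuous W) (hU : Continuous U) :
    Continuous fun x => 𝒜.acceptProb (W x) (U x) := by
  have hentry {V : X → UnitaryOp n} (hV : Continuous V) (i j : Qubits n) :
      Continuous fun x => (V x).1 i j := (continuous_subtype_val.comp hV).matrix_elem i j
  simp only [NonadaptiveAdversary.acceptProb, Matrix.mulVec, dotProduct,
    Matrix.kroneckerMap_apply, tensorPow, Matrix.of_apply]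
  refine continuous_finsetSum _ fun x _ => .pow (.norm (continuous_finsetSum _ fun y _ =>
    continuous_const.mul (continuous_finsetSum _ fun z _ => .mul (.mul (.mul ?_ ?_)
      continuous_const) continuous_const))) 2
  · exact continuous_finsetProd _ fun i _ => hentry hW _ _
  · exact continuous_finsetProd _ fun i _ => hentry hU _ _

lemma integral_acceptProb_le_of_forall_le_sum {κ : Type*} [Fintype κ] (𝒜 : NonadaptiveAdversary n)
    (U : UnitaryOp n) (X : κ → UnitaryOp n) {m : ℕ} {a : ℝ} (ha : 0 ≤ a)
    (h : ∀ V, 𝒜.acceptProb V U ≤ a * ∑ k, (1 + ‖overlap (X k).1 V.1‖) ^ m) :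
    ∫ V, 𝒜.acceptProb V U ∂(haarUnitary n) ≤
      a * (Fintype.card κ * (2 * Real.exp (2 * m ^ 2 / 2 ^ n))) := by
  have hcont (k : κ) : Continuous fun V : UnitaryOp n => (1 + ‖overlap (X k).1 V.1‖) ^ m := by
    unfold overlap
    fun_prop
  calc ∫ V, 𝒜.acceptProb V U ∂(haarUnitary n)
      ≤ ∫ V : UnitaryOp n, a * ∑ k, (1 + ‖overlap (X k).1 V.1‖) ^ m ∂(haarUnitary n) :=
        MeasureTheory.integral_mono
          (integrable_of_continuous (continuous_acceptProb 𝒜 continuous_id continuous_const))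
          (integrable_of_continuous (by fun_prop)) h
    _ = a * ∑ k, ∫ V : UnitaryOp n, (1 + ‖overlap (X k).1 V.1‖) ^ m ∂(haarUnitary n) := by
        rw [MeasureTheory.integral_const_mul,
          MeasureTheory.integral_finsetSum _ fun k _ => integrable_of_continuous (hcont k)]
    _ ≤ a * ∑ _k : κ, 2 * Real.exp (2 * m ^ 2 / 2 ^ n) := by
        gcongr with k
        exact integral_one_add_norm_overlap_pow_le m (X k)
    _ = a * (Fintype.card κ * (2 * Real.exp (2 * m ^ 2 / 2 ^ n))) := by simp

theorem exists_nonadaptive_distinguisher (lam t p : ℕ)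
    {G : Qubits lam → UnitaryOp n → UnitaryOp n}
    (hG : ∀ k, ∃ A B : UnitaryOp n, ∀ U, G k U = B * U * A) :
    ∃ 𝒜 : NonadaptiveAdversary n, 𝒜.numChallenge = t ∧ 𝒜.numHaar = p ∧
      1 / 2 - 4 * 2 ^ lam * Real.exp (2 * (t + p) ^ 2 / 2 ^ n) / (t + p).choose t ≤
        advantage lam G 𝒜.acceptProb := by
  choose A B hAB using hG
  obtain ⟨P, hP, haccept, hreject⟩ := exists_matrix_detector
    (fun k => constructionSpan t p (A k) (B k)) (c := 1 / 2) (by norm_num)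
  obtain ⟨𝒜, ht, hp, hprob⟩ := exists_nonadaptiveAdversary_acceptProb_eq (n := n) t p hP
  refine ⟨𝒜, ht, hp, sub_le_advantage (acceptProb_nonneg 𝒜) (fun k => ?_) fun U => ?_⟩
  · have hreal (U : UnitaryOp n) : 1 / 2 ≤ 𝒜.acceptProb (B k * U * A k) U := by
      have h := haccept k _ (choiVector_mem_constructionSpan (A k) (B k) U)
      have hnorm := norm_choiVector_of_mem_unitaryGroup <| tensorOp_mem_unitaryGroup
        (O := Sum.elim (fun _ : Fin t => (B k * U * A k).1) fun _ : Fin p => U.1) <| by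
          rintro (_ | _)
          exacts [(B k * U * A k).2, U.2]
      rw [← hprob, hnorm] at h
      linarith
    have hcont : Continuous fun U : UnitaryOp n => 𝒜.acceptProb (B k * U * A k) U :=
      continuous_acceptProb 𝒜 ((continuous_const_mul _).mul_const _) continuous_id
    have hint := MeasureTheory.integral_mono (μ := haarUnitary n)
      (MeasureTheory.integrable_const (1 / 2 : ℝ)) (integrable_of_continuous hcont) hreal
    simpa [hAB] using hint
  · have hideal (V : UnitaryOp n) : 𝒜.acceptProb V U ≤
        2 / (t + p).choose t * ∑ k, (1 + ‖overlap (B k * U * A k).1 V.1‖) ^ (t + p) := by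
      have h := hreject (choiVector
        (tensorOp (Sum.elim (fun _ : Fin t => V.1) fun _ : Fin p => U.1)))
      rw [← hprob] at h
      have hsum := h.trans (Finset.sum_le_sum fun k _ =>
        norm_starProjection_constructionSpan_sq_le (A k) (B k) U V)
      rw [← Finset.sum_div] at hsum
      linear_combination 2 * hsum
    have h := integral_acceptProb_le_of_forall_le_sum 𝒜 U (fun k => B k * U * A k)
      (by positivity) hideal
    refine h.trans_eq ?_
    simp only [Fintype.card_pi, Fintype.card_bool, Finset.prod_const, Finset.card_univ,
      Fintype.card_fin, Nat.cast_pow, Nat.cast_ofNat, Nat.cast_add]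
    ring

end NonadaptiveDistinguisher

/-! ### Adaptive simulation of non-adaptive adversaries -/

section Relabel

variable {ρ ι : Type*} [Fintype ρ] [Fintype ι] [DecidableEq ι]

lemma exists_unitary_mulVec_single (x₀ : ι) {φ : ι → ℂ} (hφ : ∑ x, ‖φ x‖ ^ 2 = 1) :
    ∃ V : Matrix.unitaryGroup ι ℂ, V.1 *ᵥ Pi.single x₀ 1 = φ := by
  let v : EuclideanSpace ℂ ι := WithLp.toLp 2 φ
  have hv : ‖v‖ = 1 := by
    rw [← pow_eq_one_iff_of_nonneg (norm_nonneg v) two_ne_zero, EuclideanSpace.norm_sq_eq]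
    exact hφ
  have hv_orthonormal : Orthonormal ℂ (({x₀} : Set ι).domRestrict fun _ => v) :=
    ⟨fun _ => hv, fun i j hij => absurd (Subsingleton.elim i j) hij⟩
  obtain ⟨b, hb⟩ := hv_orthonormal.exists_orthonormalBasis_extension_of_card_eq (by simp)
  refine ⟨⟨_, (EuclideanSpace.basisFun ι ℂ).toMatrix_orthonormalBasis_mem_unitary b⟩, ?_⟩
  ext x
  rw [Matrix.mulVec_single_one]
  change b x₀ x = φ x
  rw [hb x₀ rfl]

lemma sum_norm_sq_unitary_mulVec (V : Matrix.unitaryGroup ι ℂ) (φ : ι → ℂ) :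
    ∑ x, ‖(V.1 *ᵥ φ) x‖ ^ 2 = ∑ x, ‖φ x‖ ^ 2 := by
  have hsum (ψ : ι → ℂ) : ((∑ x, ‖ψ x‖ ^ 2 : ℝ) : ℂ) = star ψ ⬝ᵥ ψ := by
    simp [dotProduct, Complex.conj_mul']
  apply Complex.ofReal_injective
  rw [hsum, hsum, Matrix.star_mulVec, ← Matrix.dotProduct_mulVec, Matrix.mulVec_mulVec,
    ← Matrix.star_eq_conjTranspose, Matrix.UnitaryGroup.star_mul_self, Matrix.one_mulVec]

lemma isStarProjection_star_mul_mul {M : Matrix ι ι ℂ} (hM : IsStarProjection M)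
    (V : Matrix.unitaryGroup ι ℂ) : IsStarProjection (star V.1 * M * V.1) := by
  refine ⟨?_, hM.isSelfAdjoint.conjugate' V.1⟩
  calc star V.1 * M * V.1 * (star V.1 * M * V.1)
      = star V.1 * M * (V.1 * star V.1) * M * V.1 := by simp only [mul_assoc]
    _ = star V.1 * M * V.1 := by
      rw [Matrix.mem_unitaryGroup_iff.1 V.2, mul_one, mul_assoc (star V.1), hM.isIdempotentElem.eq]

variable [DecidableEq ρ]

/-- The permutation unitary that moves amplitudes from one labelling of a basis to another. -/
def relabelUnitary (e f : ρ ≃ ι) : Matrix.unitaryGroup ι ℂ :=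
  ⟨(1 : Matrix ρ ρ ℂ).submatrix f.symm e.symm, by
    rw [Matrix.mem_unitaryGroup_iff, Matrix.star_eq_conjTranspose, Matrix.conjTranspose_submatrix,
      Matrix.submatrix_mul_equiv, Matrix.conjTranspose_one, Matrix.one_mul,
      Matrix.submatrix_one_equiv]⟩

lemma relabelUnitary_mulVec (e f : ρ ≃ ι) (ψ : ρ → ℂ) :
    (relabelUnitary e f).1 *ᵥ (ψ ∘ e.symm) = ψ ∘ f.symm := by
  rw [relabelUnitary, Matrix.submatrix_mulVec_equiv, Matrix.one_mulVec, Equiv.symm_symm,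
    Function.comp_assoc ψ, Equiv.symm_comp_self, Function.comp_id]

end Relabel

section Simulation

variable {n : ℕ}

/-- The unitary that answers the queries to the oracle `o`, when `W` is the challenge oracle and `U`
the common one. -/
def oracle (W U : UnitaryOp n) (o : OracleName) : UnitaryOp n :=
  match o with
  | .challenge => W
  | .haar => U

/-- The action of a query on the query register and `anc` ancillary qubits. -/
def query (anc : ℕ) (W U : UnitaryOp n) (o : OracleName) :
    Matrix (Qubits n × Qubits anc) (Qubits n × Qubits anc) ℂ :=
  (oracle W U o).1 ⊗ₖ 1

lemma view_eq_foldl (ℬ : Adversary n) (W U : UnitaryOp n) :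
    ℬ.view W U = ℬ.steps.foldl (fun ψ s => query ℬ.anc W U s.2 *ᵥ (s.1.1 *ᵥ ψ))
      (Pi.single (fun _ => false, fun _ => false) 1) := by
  unfold Adversary.view
  congr 1
  funext ψ s
  obtain ⟨V, _ | _⟩ := s <;> rfl

variable {ρ : Type*} [Fintype ρ] {anc : ℕ}

lemma exists_steps_foldl_eq (e : ρ ≃ Qubits n × Qubits anc) {φ : ρ → ℂ}
    (hφ : ∑ x, ‖φ x‖ ^ 2 = 1) (l : List ((ρ ≃ Qubits n × Qubits anc) × OracleName)) :
    ∃ (steps : List (Matrix.unitaryGroup (Qubits n × Qubits anc) ℂ × OracleName))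
      (V : Matrix.unitaryGroup (Qubits n × Qubits anc) ℂ),
      steps.map Prod.snd = l.map Prod.snd ∧ ∀ W U : UnitaryOp n,
        V.1 *ᵥ steps.foldl (fun ψ s => query anc W U s.2 *ᵥ (s.1.1 *ᵥ ψ))
          (Pi.single (fun _ => false, fun _ => false) 1) =
        l.foldl (fun ψ q => (query anc W U q.2).submatrix q.1 q.1 *ᵥ ψ) φ ∘ e.symm := by
  classical
  induction l using List.reverseRecOn with
  | nil =>
    have hφe : ∑ x, ‖(φ ∘ e.symm) x‖ ^ 2 = 1 := (e.symm.sum_comp fun x => ‖φ x‖ ^ 2).trans hφ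
    obtain ⟨V, hV⟩ := exists_unitary_mulVec_single (fun _ => false, fun _ => false) hφe
    exact ⟨[], V, rfl, fun _ _ => hV⟩
  | append_singleton l q ih =>
    obtain ⟨steps, V, hnames, hstate⟩ := ih
    refine ⟨steps ++ [(relabelUnitary e q.1 * V, q.2)], relabelUnitary q.1 e,
      by simp [hnames], fun W U => ?_⟩
    simp only [List.foldl_append, List.foldl_cons, List.foldl_nil, Submonoid.coe_mul]
    rw [← Matrix.mulVec_mulVec, hstate, relabelUnitary_mulVec, ← relabelUnitary_mulVec q.1 e,
      Matrix.submatrix_mulVec_equiv, Function.comp_assoc, Equiv.self_comp_symm, Function.comp_id]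

theorem exists_adversary_acceptProb_eq_foldl (e : ρ ≃ Qubits n × Qubits anc) {φ : ρ → ℂ}
    (hφ : ∑ x, ‖φ x‖ ^ 2 = 1) {M : Matrix ρ ρ ℂ} (hM : IsStarProjection M)
    (l : List ((ρ ≃ Qubits n × Qubits anc) × OracleName)) :
    ∃ ℬ : Adversary n, (∀ o, ℬ.queries o = (l.map Prod.snd).count o) ∧ ∀ W U,
      ℬ.acceptProb W U = ∑ x, ‖(M *ᵥ
        l.foldl (fun ψ q => (query anc W U q.2).submatrix q.1 q.1 *ᵥ ψ) φ) x‖ ^ 2 := by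
  obtain ⟨steps, V, hnames, hstate⟩ := exists_steps_foldl_eq e hφ l
  refine ⟨⟨anc, steps, star V.1 * M.submatrix e.symm e.symm * V.1, isStarProjection_star_mul_mul
    (isStarProjection_submatrix_equiv hM e.symm) V⟩, fun o => ?_, fun W U => ?_⟩
  · rw [← hnames, List.count, List.countP_map]
    exact List.countP_congr fun s _ => by simp
  · rw [Adversary.acceptProb, view_eq_foldl]
    simp only [mul_assoc, ← Matrix.mulVec_mulVec, hstate]
    refine (sum_norm_sq_unitary_mulVec V⁻¹ _).trans ?_
    rw [Matrix.submatrix_mulVec_equiv, Function.comp_assoc, Equiv.symm_symm,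
      Equiv.symm_comp_self, Function.comp_id]
    exact e.symm.sum_comp fun x => ‖(M *ᵥ _) x‖ ^ 2

end Simulation

section Registers

variable {σ d α β R : Type*} [Fintype σ] [DecidableEq σ] [DecidableEq d] [DecidableEq α]
  [DecidableEq β] [CommRing R]

lemma tensorOp_update_one (i : σ) (O : Matrix d d R) :
    tensorOp (Function.update (fun _ => 1) i O) =
      (O ⊗ₖ (1 : Matrix ({j // j ≠ i} → d) _ R)).submatrix
        (Equiv.funSplitAt i d) (Equiv.funSplitAt i d) := by
  ext x y
  rw [tensorOp_apply, Fintype.prod_eq_mul_prod_subtype_ne _ i, ← tensorOp_one]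
  simp only [tensorOp_apply, Function.update_self, Matrix.submatrix_apply,
    Matrix.kroneckerMap_apply, Equiv.funSplitAt_apply]
  congr 1
  exact Finset.prod_congr rfl fun j _ => by rw [Function.update_of_ne j.2]

/-- The register `i` separated from the other registers and the ancillas `α`, which are
relabelled by `β`. -/
def splitRegister (i : σ) (g : ({j // j ≠ i} → d) × α ≃ β) : (σ → d) × α ≃ d × β :=
  (((Equiv.funSplitAt i d).prodCongr (Equiv.refl α)).trans (Equiv.prodAssoc _ _ _)).trans
    ((Equiv.refl d).prodCongr g)

lemma kronecker_one_submatrix_splitRegister (i : σ) (g : ({j // j ≠ i} → d) × α ≃ β)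
    (O : Matrix d d R) :
    (O ⊗ₖ (1 : Matrix β β R)).submatrix (splitRegister i g) (splitRegister i g) =
      tensorOp (Function.update (fun _ => 1) i O) ⊗ₖ (1 : Matrix α α R) := by
  ext x y
  simp only [splitRegister, Equiv.coe_trans, Equiv.prodCongr_apply, Equiv.coe_refl,
    Matrix.submatrix_apply, Function.comp_apply, Equiv.prodAssoc_apply, Prod.map_fst,
    Equiv.funSplitAt_apply, Prod.map_snd, id_eq, Prod.map_apply, Matrix.kroneckerMap_apply,
    Matrix.one_apply, EmbeddingLike.apply_eq_iff_eq, Prod.ext_iff, ite_and, mul_ite, mul_one,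
    mul_zero, tensorOp_update_one]
  split_ifs <;> rfl

variable [Fintype d] [Fintype α]

lemma foldl_tensorOp_update_one (O : σ → Matrix d d R) {l : List σ} (hl : l.Nodup)
    (φ : (σ → d) × α → R) :
    l.foldl (fun ψ i => (tensorOp (Function.update (fun _ => 1) i (O i)) ⊗ₖ
        (1 : Matrix α α R)) *ᵥ ψ) φ =
      (tensorOp (fun i => if i ∈ l then O i else 1) ⊗ₖ (1 : Matrix α α R)) *ᵥ φ := by
  induction l generalizing φ with
  | nil => simp [tensorOp_one]
  | cons i l ih =>
    obtain ⟨hi, hl⟩ := List.nodup_cons.1 hl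
    rw [List.foldl_cons, ih hl, Matrix.mulVec_mulVec, ← Matrix.mul_kronecker_mul, tensorOp_mul,
      Matrix.one_mul]
    congr 3
    funext j
    obtain rfl | hj := eq_or_ne j i
    · simp [hi]
    · simp [hj]

end Registers

section AdaptiveSimulation

open scoped Finset

variable {n : ℕ}

lemma nonempty_splitRegister_ancilla_equiv {σ : Type*} [Fintype σ] (a : ℕ) (i : σ) :
    Nonempty (({j // j ≠ i} → Qubits n) × Qubits a ≃
      Qubits (n * (Fintype.card σ - 1) + a)) := by
  classical
  refine ⟨Fintype.equivOfCardEq ?_⟩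
  simp [Fintype.card_subtype_compl, pow_add, pow_mul]

theorem exists_adversary_acceptProb_eq_tensorOp {σ : Type*} [Fintype σ] [DecidableEq σ]
    [Nonempty σ] (o : σ → OracleName) {a : ℕ} {φ : (σ → Qubits n) × Qubits a → ℂ}
    (hφ : ∑ x, ‖φ x‖ ^ 2 = 1)
    {M : Matrix ((σ → Qubits n) × Qubits a) ((σ → Qubits n) × Qubits a) ℂ}
    (hM : IsStarProjection M) :
    ∃ ℬ : Adversary n, (∀ c, ℬ.queries c = #{i | o i = c}) ∧ ∀ W U,
      ℬ.acceptProb W U =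
        ∑ x, ‖(M *ᵥ ((tensorOp (fun i => (oracle W U (o i)).1) ⊗ₖ 1) *ᵥ φ)) x‖ ^ 2 := by
  let g (i : σ) := (nonempty_splitRegister_ancilla_equiv (n := n) a i).some
  let e (i : σ) := splitRegister i (g i)
  obtain ⟨ℬ, hqueries, haccept⟩ := exists_adversary_acceptProb_eq_foldl
    (e (Classical.arbitrary σ)) hφ hM ((Finset.univ : Finset σ).toList.map fun i => (e i, o i))
  refine ⟨ℬ, fun c => ?_, fun W U => ?_⟩
  · rw [hqueries, List.map_map, List.count, List.countP_map,
      ← Finset.toList_toFinset (Finset.univ : Finset σ),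
      (Finset.nodup_toList _).card_eq_countP, Finset.toList_toFinset]
    exact List.countP_congr fun i _ => by simp
  · rw [haccept, List.foldl_map]
    simp only [query, e, kronecker_one_submatrix_splitRegister]
    rw [foldl_tensorOp_update_one _ (Finset.nodup_toList _)]
    simp

theorem exists_adaptive_simulation (𝒜 : NonadaptiveAdversary n)
    (hq : 0 < 𝒜.numChallenge + 𝒜.numHaar) :
    ∃ ℬ : Adversary n, ℬ.queries .challenge = 𝒜.numChallenge ∧
      ℬ.queries .haar = 𝒜.numHaar ∧ ℬ.acceptProb = 𝒜.acceptProb := by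
  let e := registerEquiv n 𝒜.numChallenge 𝒜.numHaar (Equiv.refl (Qubits 𝒜.anc))
  have : Nonempty (Fin 𝒜.numChallenge ⊕ Fin 𝒜.numHaar) := ⟨finSumFinEquiv.symm ⟨0, hq⟩⟩
  obtain ⟨ℬ, hqueries, haccept⟩ := exists_adversary_acceptProb_eq_tensorOp
    (Sum.elim (fun _ => .challenge) fun _ => .haar)
    ((e.symm.sum_comp fun x => ‖𝒜.init x‖ ^ 2).trans 𝒜.norm_init)
    (isStarProjection_submatrix_equiv 𝒜.isStarProjection_meas e.symm)
  refine ⟨ℬ, ?_, ?_, ?_⟩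
  · simp only [hqueries, Finset.card_filter, Fintype.sum_sum_type, Sum.elim_inl, Sum.elim_inr]
    simp
  · simp only [hqueries, Finset.card_filter, Fintype.sum_sum_type, Sum.elim_inl, Sum.elim_inr]
    simp
  · funext W U
    have horacle : (fun i => (oracle W U (Sum.elim (fun _ : Fin 𝒜.numChallenge => .challenge)
        (fun _ : Fin 𝒜.numHaar => .haar) i)).1) = Sum.elim (fun _ => W.1) fun _ => U.1 := by
      funext i
      cases i <;> rfl
    rw [haccept, acceptProb_eq_sum_tensorOp 𝒜 (Equiv.refl _), horacle]
    rfl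

end AdaptiveSimulation

/-! ### Parameters -/

section Parameters

open Filter Asymptotics

lemma not_exists_negligible_ge {δ : ℕ → ℝ} {c : ℝ} (hc : 0 < c) (h : ∀ᶠ lam in atTop, c ≤ δ lam) :
    ¬ ∃ ε, Negligible ε ∧ ∀ lam, δ lam ≤ ε lam := by
  rintro ⟨ε, ⟨-, hε⟩, hle⟩
  have hlim : Tendsto ε atTop (nhds 0) := by simpa using hε 0
  exact hc.not_ge (ge_of_tendsto hlim (h.mono fun lam hlam => hlam.trans (hle lam)))

lemma pow_le_choose_add (t p : ℕ) : ((p : ℝ) / t) ^ t ≤ (t + p).choose t := by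
  have hfact : (t.factorial : ℝ) ≤ (t : ℝ) ^ t := by exact_mod_cast Nat.factorial_le_pow t
  calc ((p : ℝ) / t) ^ t = (p : ℝ) ^ t / (t : ℝ) ^ t := div_pow _ _ _
    _ ≤ ((t + p + 1 - t : ℕ) : ℝ) ^ t / t.factorial := by
      gcongr
      omega
    _ ≤ (t + p).choose t := Nat.pow_le_choose t (t + p)

lemma four_pow_le_exp (lam : ℕ) : (4 : ℝ) ^ lam ≤ Real.exp (2 * lam) := by
  have he : (2 : ℝ) ≤ Real.exp 1 := by linarith [Real.exp_one_gt_d9]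
  calc (4 : ℝ) ^ lam = (2 ^ 2) ^ lam := by norm_num
    _ ≤ (Real.exp 1 ^ 2) ^ lam := by gcongr
    _ = Real.exp (2 * lam) := by
      rw [← pow_mul, ← Real.exp_nat_mul]
      push_cast
      ring_nf

lemma two_pow_le_choose {lam t p C : ℕ} (hlam : 6 ≤ lam) (ht : t ≤ lam)
    (hlog : (lam : ℝ) ≤ C * t * Real.log lam) (hp : lam ^ (2 * C + 1) ≤ p) :
    48 * (2 : ℝ) ^ lam ≤ (t + p).choose t := by
  have hlam_pos : (0 : ℝ) < lam := by exact_mod_cast (by omega : 0 < lam)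
  have ht_pos : (0 : ℝ) < t := by
    refine t.cast_nonneg.lt_of_ne fun h => ?_
    rw [← h, mul_zero, zero_mul] at hlog
    exact hlam_pos.not_ge hlog
  have hconst : (48 : ℝ) ≤ 2 ^ lam :=
    (by norm_num : (48 : ℝ) ≤ 2 ^ 6).trans (pow_le_pow_right₀ one_le_two hlam)
  have hbase : (lam : ℝ) ^ (2 * C) ≤ p / t := by
    rw [le_div_iff₀ ht_pos]
    calc (lam : ℝ) ^ (2 * C) * t ≤ (lam : ℝ) ^ (2 * C) * lam := by gcongr
      _ = (lam : ℝ) ^ (2 * C + 1) := (pow_succ _ _).symm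
      _ ≤ p := by exact_mod_cast hp
  calc 48 * (2 : ℝ) ^ lam ≤ 2 ^ lam * 2 ^ lam := by gcongr
    _ = 4 ^ lam := by rw [← mul_pow]; norm_num
    _ ≤ Real.exp (2 * lam) := four_pow_le_exp lam
    _ ≤ Real.exp (t * Real.log ((lam : ℝ) ^ (2 * C))) := by
      rw [Real.exp_le_exp, Real.log_pow]
      push_cast
      linarith
    _ = ((lam : ℝ) ^ (2 * C)) ^ t := by
      rw [Real.exp_nat_mul, Real.exp_log (by positivity)]
    _ ≤ ((p : ℝ) / t) ^ t := by gcongr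
    _ ≤ (t + p).choose t := pow_le_choose_add t p

lemma two_mul_queries_sq_le_two_pow {lam m n t : ℕ} (hlam : 18 ≤ lam) (hm : m ≠ 0) (ht : t ≤ lam)
    (hn : (lam : ℝ) ^ (2 * m + 1) ≤ 2 ^ n) :
    2 * ((t : ℝ) + (lam ^ m + 1 : ℕ)) ^ 2 ≤ 2 ^ n := by
  have hlam' : (18 : ℝ) ≤ lam := by exact_mod_cast hlam
  have ht' : (t : ℝ) ≤ (lam : ℝ) ^ m := by
    exact_mod_cast ht.trans (Nat.le_self_pow hm lam)
  have hone : (1 : ℝ) ≤ (lam : ℝ) ^ m := one_le_pow₀ (by linarith)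
  calc 2 * ((t : ℝ) + (lam ^ m + 1 : ℕ)) ^ 2 ≤ 2 * (3 * (lam : ℝ) ^ m) ^ 2 := by
        gcongr
        push_cast
        linarith
    _ = 18 * (lam : ℝ) ^ (2 * m) := by ring
    _ ≤ lam * (lam : ℝ) ^ (2 * m) := by gcongr
    _ = (lam : ℝ) ^ (2 * m + 1) := (pow_succ' _ _).symm
    _ ≤ 2 ^ n := hn

variable {n ℓ : ℕ → ℕ}

lemma eventually_pow_le_two_pow
    (hn : (fun lam : ℕ => Real.log (lam : ℝ)) =o[atTop] fun lam : ℕ => (n lam : ℝ)) (m : ℕ) :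
    ∀ᶠ lam : ℕ in atTop, (lam : ℝ) ^ m ≤ 2 ^ n lam := by
  have hlog2 : 0 < Real.log 2 := Real.log_pos one_lt_two
  filter_upwards [eventually_gt_atTop 0, (hn.const_mul_left (m : ℝ)).bound hlog2] with lam hlam hle
  rw [← Real.log_le_log_iff (pow_pos (Nat.cast_pos.2 hlam) m) (by positivity), Real.log_pow,
    Real.log_pow]
  calc (m : ℝ) * Real.log lam ≤ ‖(m : ℝ) * Real.log lam‖ := le_abs_self _
    _ ≤ Real.log 2 * ‖(n lam : ℝ)‖ := hle
    _ = n lam * Real.log 2 := by rw [RCLike.norm_natCast, mul_comm]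

lemma exists_eventually_le_mul_min_mul_log
    (hℓ : (fun lam : ℕ => (lam : ℝ) / Real.log (lam : ℝ)) =O[atTop] fun lam : ℕ => (ℓ lam : ℝ)) :
    ∃ C : ℕ, ∀ᶠ lam : ℕ in atTop, (lam : ℝ) ≤ C * (min (ℓ lam) lam : ℕ) * Real.log lam := by
  obtain ⟨c, hc⟩ := hℓ.bound
  obtain ⟨C, hC⟩ := exists_nat_ge (max c 1)
  refine ⟨C, ?_⟩
  filter_upwards [eventually_ge_atTop 3, hc] with lam hlam hle
  have hlam' : (3 : ℝ) ≤ lam := by exact_mod_cast hlam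
  have hlog : 1 ≤ Real.log lam := by
    rw [Real.le_log_iff_exp_le (by linarith)]
    linarith [Real.exp_one_lt_d9]
  have hlog_pos : 0 < Real.log lam := one_pos.trans_le hlog
  rw [Real.norm_of_nonneg (by positivity), RCLike.norm_natCast, div_le_iff₀ hlog_pos] at hle
  rcases min_choice (ℓ lam) lam with hmin | hmin <;> rw [hmin]
  · refine hle.trans ?_
    gcongr
    exact (le_max_left c 1).trans hC
  · calc (lam : ℝ) = 1 * lam * 1 := by ring
      _ ≤ C * lam * Real.log lam := by
        gcongr
        exact (le_max_right c 1).trans hC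

theorem exists_nonadaptive_adversaries
    (hn : (fun lam : ℕ => Real.log (lam : ℝ)) =o[atTop] fun lam : ℕ => (n lam : ℝ))
    (hℓ : (fun lam : ℕ => (lam : ℝ) / Real.log (lam : ℝ)) =O[atTop] fun lam : ℕ => (ℓ lam : ℝ))
    {G : OracleConstruction n}
    (hG : ∀ (lam : ℕ) (k : Qubits lam), ∃ A B : UnitaryOp (n lam),
      ∀ U : UnitaryOp (n lam), G lam k U = B * U * A) :
    ∃ (m : ℕ) (𝒜 : ∀ lam, NonadaptiveAdversary (n lam)),
      (∀ lam, (𝒜 lam).numChallenge ≤ ℓ lam) ∧ (∀ lam, (𝒜 lam).numHaar = lam ^ m + 1) ∧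
      ∀ᶠ lam in atTop, (1 / 4 : ℝ) ≤ advantage lam (G lam) (𝒜 lam).acceptProb := by
  obtain ⟨C, hC⟩ := exists_eventually_le_mul_min_mul_log hℓ
  choose 𝒜 hchallenge hhaar hadv using fun lam =>
    exists_nonadaptive_distinguisher lam (min (ℓ lam) lam) (lam ^ (2 * C + 1) + 1) (hG lam)
  refine ⟨2 * C + 1, 𝒜, fun lam => (hchallenge lam).trans_le (min_le_left _ _), hhaar, ?_⟩
  filter_upwards [eventually_ge_atTop 18, hC, eventually_pow_le_two_pow hn (2 * (2 * C + 1) + 1)]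
    with lam hlam hClam hnlam
  refine le_trans ?_ (hadv lam)
  set t := min (ℓ lam) lam
  set p := lam ^ (2 * C + 1) + 1
  have ht : t ≤ lam := min_le_right _ _
  have hchoose : 48 * (2 : ℝ) ^ lam ≤ (t + p).choose t :=
    two_pow_le_choose (by omega) ht hClam (Nat.le_succ _)
  have hexp : Real.exp (2 * ((t : ℝ) + p) ^ 2 / 2 ^ n lam) ≤ 3 := by
    have hexponent : 2 * ((t : ℝ) + p) ^ 2 / 2 ^ n lam ≤ 1 :=
      (div_le_one (by positivity)).2 (two_mul_queries_sq_le_two_pow hlam (by omega) ht hnlam)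
    linarith [Real.exp_le_exp.2 hexponent, Real.exp_one_lt_d9]
  have hratio : 4 * 2 ^ lam * Real.exp (2 * ((t : ℝ) + p) ^ 2 / 2 ^ n lam) / (t + p).choose t ≤
      1 / 4 := by
    calc 4 * 2 ^ lam * Real.exp (2 * ((t : ℝ) + p) ^ 2 / 2 ^ n lam) / (t + p).choose t
        ≤ 4 * 2 ^ lam * 3 / (48 * 2 ^ lam) := by gcongr
      _ = 1 / 4 := by field_simp; norm_num
  linarith

end Parameters

end HaarPRU

end

theorem mainTheorem4_general (n ℓ : ℕ → ℕ)
    (hn : (fun lam : ℕ => Real.log (lam : ℝ)) =o[Filter.atTop] fun lam : ℕ => (n lam : ℝ))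
    (hℓ : (fun lam : ℕ => (lam : ℝ) / Real.log (lam : ℝ)) =O[Filter.atTop]
      fun lam : ℕ => (ℓ lam : ℝ))
    (G : HaarPRU.OracleConstruction n)
    (hG : ∀ (lam : ℕ) (k : HaarPRU.Qubits lam), ∃ A B : HaarPRU.UnitaryOp (n lam),
      ∀ U : HaarPRU.UnitaryOp (n lam), G lam k U = B * U * A) :
    ¬ HaarPRU.IsQuerySecurePRU n ℓ G ∧ ¬ HaarPRU.IsNonadaptivelyQuerySecurePRU n ℓ G := by
  obtain ⟨m, 𝒜, hchallenge, hhaar, hadv⟩ := HaarPRU.exists_nonadaptive_adversaries hn hℓ hG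
  have hinsecure := HaarPRU.not_exists_negligible_ge (by norm_num) hadv
  have hpoly (lam : ℕ) : lam ^ m + 1 ≤ (Polynomial.X ^ m + 1 : Polynomial ℕ).eval lam := by simp
  refine ⟨fun hsecure => hinsecure ?_, fun hsecure => hinsecure <|
    hsecure 𝒜 hchallenge ⟨_, fun lam => (hhaar lam).trans_le (hpoly lam)⟩⟩
  choose ℬ hchallenge' hhaar' haccept using fun lam =>
    HaarPRU.exists_adaptive_simulation (𝒜 lam) (by rw [hhaar]; omega)
  simpa only [haccept] using hsecure ℬ (fun lam => (hchallenge' lam).trans_le (hchallenge lam))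
    ⟨_, fun lam => ((hhaar' lam).trans (hhaar lam)).trans_le (hpoly lam)⟩

theorem mainTheorem4 (n ℓ : ℕ → ℕ)
    (hn : (fun lam : ℕ => Real.log (lam : ℝ)) =o[Filter.atTop] fun lam : ℕ => (n lam : ℝ))
    (hℓ : (fun lam : ℕ => (lam : ℝ) / Real.log (lam : ℝ)) =o[Filter.atTop]
      fun lam : ℕ => (ℓ lam : ℝ))
    (G : HaarPRU.OracleConstruction n)
    (hG : ∀ (lam : ℕ) (k : HaarPRU.Qubits lam), ∃ A B : HaarPRU.UnitaryOp (n lam),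
      ∀ U : HaarPRU.UnitaryOp (n lam), G lam k U = B * U * A) :
    ¬ HaarPRU.IsQuerySecurePRU n ℓ G ∧ ¬ HaarPRU.IsNonadaptivelyQuerySecurePRU n ℓ G :=
  mainTheorem4_general n ℓ hn hℓ.isBigO G hG
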